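/- **Theorem.** Let $n,m,d\ge 0$ be integers, let $\mathsf{Ext}=\{f_s:[2^n]\to[2^m]\}_{s\in[2^d]}$ be a family of functions, and let $k\le n$ be a real number. Let $$\mathrm{Err}(\mathsf{Ext},k):=\sup\ \frac1{2^d}\sum_{i,s,j}\Big[\delta_{f_s(i)=j}-\frac1{2^m}\Big]z_i\,y_{(s,j)},$$ where $i\in[2^n]$, $s\in[2^d]$, $j\in[2^m]$, and the supremum is over real $z_i,y_{(s,j)}$ with $0\le z_i\le 2^{-k}$, $\sum_i z_i=1$ and $0\le y_{(s,j)}\le 1$. Let $$\mathrm{Err}^{\overline{\mathrm{sdp}}_1}(\mathsf{Ext},k):=\sup\ \frac1{2^d}\sum_{i,s,j}\Big[\delta_{f_s(i)=j}-\frac1{2^m}\Big]\Omega_{(i),(s,j)},$$ where the supremum is over all positive semidefinite matrices $\Omega$ of size $1+2^n+2^{d+m}$, with rows and columns indexed by the words $w$ of length at most one (the empty word $\emptyset$, the words $(i)$ and the words $(s,j)$), such that for all $w,w',i,s,j$ $$\Omega_{w,w'}\ge 0,\quad \Omega_{\emptyset,\emptyset}=1,\quad \Omega_{\emptyset,w}=\sum_{i'}\Omega_{(i'),w},\quad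 2^{-k}\,\Omega_{\emptyset,w}\ge\Omega_{(i),w},\quad \Omega_{\emptyset,w}\ge\Omega_{(s,j),w}.$$ Then $$\mathrm{Err}^{\overline{\mathrm{sdp}}_1}(\mathsf{Ext},k)\le\sqrt2\,\sqrt{2^m}\,\sqrt{\mathrm{Err}(\mathsf{Ext},k)}$$ and $$\mathrm{Err}^{\overline{\mathrm{sdp}}_1}(\mathsf{Ext},k)\le 6\,K_G\,2^{n-k}\,\mathrm{Err}(\mathsf{Ext},k-1),$$ where $K_G$ is the (real) Grothendieck constant, i.e. the least $K$ such that for every real $p\times q$ matrix $A$ and all vectors $\vec a_i,\vec b_j$ of norm at most $1$ in a Euclidean space of any finite dimension, $\sum_{i,j}A_{ij}\,\vec a_i\cdot\vec b_j\le K\max\{\sum_{i,j}A_{ij}a_ib_j: a_i,b_j\in[-1,1]\}$. -/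

import Mathlib

noncomputable section

namespace QProofExtractor

/-! ### Grothendieck's constant -/

/-- `max { ∑ A i j * a i * b j : |a i| ≤ 1, |b j| ≤ 1 }` for a real matrix `A`. -/
def scalarMax {p q : ℕ} (A : Matrix (Fin p) (Fin q) ℝ) : ℝ :=
  sSup {t : ℝ | ∃ (a : Fin p → ℝ) (b : Fin q → ℝ),
    (∀ i, |a i| ≤ 1) ∧ (∀ j, |b j| ≤ 1) ∧ t = ∑ i, ∑ j, A i j * (a i * b j)}

/-- The real Grothendieck inequality holds with constant `K`, for all real matrices and all
families of vectors in the unit ball of a Euclidean space of arbitrary finite dimension. -/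
def GrothendieckInequality (K : ℝ) : Prop :=
  ∀ (p q : ℕ) (A : Matrix (Fin p) (Fin q) ℝ) (r : ℕ)
    (x : Fin p → EuclideanSpace ℝ (Fin r)) (y : Fin q → EuclideanSpace ℝ (Fin r)),
    (∀ i, ‖x i‖ ≤ 1) → (∀ j, ‖y j‖ ≤ 1) →
      ∑ i, ∑ j, A i j * inner ℝ (x i) (y j) ≤ K * scalarMax A

/-- Grothendieck's (real) constant: the least `K` for which Grothendieck's inequality holds. -/
def grothendieckConstant : ℝ := sInf {K : ℝ | GrothendieckInequality K}

/-! ### Extractors and their classical error -/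

/-- A family of functions `f_s : [2^n] → [2^m]` with seed `s ∈ [2^d]`. -/
abbrev Extractor (n m d : ℕ) : Type := Fin (2 ^ d) → Fin (2 ^ n) → Fin (2 ^ m)

variable {n m d : ℕ}

/-- The coefficient `δ_{f_s(i) = j} - 1 / 2^m`. -/
def coeff (Ext : Extractor n m d) (i : Fin (2 ^ n)) (s : Fin (2 ^ d)) (j : Fin (2 ^ m)) : ℝ :=
  (if Ext s i = j then 1 else 0) - 1 / 2 ^ m

/-- Feasible points of the classical program: a distribution `z` on `[2^n]` of min-entropy at
least `k`, and a test function `y` on `[2^d] × [2^m]`. -/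
structure ClassicalFeasible (k : ℝ) (z : Fin (2 ^ n) → ℝ) (y : Fin (2 ^ d) × Fin (2 ^ m) → ℝ) :
    Prop where
  z_nonneg : ∀ i, 0 ≤ z i
  z_le : ∀ i, z i ≤ (2 : ℝ) ^ (-k)
  z_sum : ∑ i, z i = 1
  y_nonneg : ∀ sj, 0 ≤ y sj
  y_le : ∀ sj, y sj ≤ 1

def classicalObjective (Ext : Extractor n m d) (z : Fin (2 ^ n) → ℝ)
    (y : Fin (2 ^ d) × Fin (2 ^ m) → ℝ) : ℝ :=
  1 / 2 ^ d * ∑ i, ∑ s, ∑ j, coeff Ext i s j * (z i * y (s, j))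

/-- The values of the classical program at its feasible points. -/
def classicalValues (Ext : Extractor n m d) (k : ℝ) : Set ℝ :=
  {t | ∃ (z : Fin (2 ^ n) → ℝ) (y : Fin (2 ^ d) × Fin (2 ^ m) → ℝ),
    ClassicalFeasible k z y ∧ t = classicalObjective Ext z y}

/-- `Err(Ext, k)`, the classical error of the extractor. -/
def Err (Ext : Extractor n m d) (k : ℝ) : ℝ := sSup (classicalValues Ext k)

/-! ### The simplified first level relaxation -/

/-- Words of length at most one in the symbols `i ∈ [2^n]` and `(s, j) ∈ [2^d] × [2^m]`. -/
abbrev Word (n m d : ℕ) : Type := Option (Fin (2 ^ n) ⊕ (Fin (2 ^ d) × Fin (2 ^ m)))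

/-- The empty word. -/
abbrev emptyW : Word n m d := none

/-- The one-letter word `(i)`. -/
abbrev inW (i : Fin (2 ^ n)) : Word n m d := some (Sum.inl i)

/-- The one-letter word `(s, j)`. -/
abbrev testW (s : Fin (2 ^ d)) (j : Fin (2 ^ m)) : Word n m d := some (Sum.inr (s, j))

/-- Feasible points of the simplified first level relaxation. All the entries are nonnegative,
hence real, so that the positive semidefinite matrices concerned are real symmetric ones. -/
structure SdpFeasible (k : ℝ) (Ω : Matrix (Word n m d) (Word n m d) ℝ) : Prop where
  posSemidef : Ω.PosSemidef
  nonneg : ∀ w w', 0 ≤ Ω w w'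
  empty_empty : Ω emptyW emptyW = 1
  empty_eq_sum : ∀ w, Ω emptyW w = ∑ i, Ω (inW i) w
  in_le : ∀ i w, Ω (inW i) w ≤ (2 : ℝ) ^ (-k) * Ω emptyW w
  test_le : ∀ s j w, Ω (testW s j) w ≤ Ω emptyW w

def sdpObjective (Ext : Extractor n m d) (Ω : Matrix (Word n m d) (Word n m d) ℝ) : ℝ :=
  1 / 2 ^ d * ∑ i, ∑ s, ∑ j, coeff Ext i s j * Ω (inW i) (testW s j)

/-- The values of the simplified first level relaxation at its feasible points. -/
def sdpValues (Ext : Extractor n m d) (k : ℝ) : Set ℝ :=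
  {t | ∃ Ω : Matrix (Word n m d) (Word n m d) ℝ, SdpFeasible k Ω ∧ t = sdpObjective Ext Ω}

/-- The value of the simplified first level relaxation. -/
def ErrSdp (Ext : Extractor n m d) (k : ℝ) : ℝ := sSup (sdpValues Ext k)

/-! ### The suprema above are over nonempty bounded sets -/

theorem scalarMax_nonempty {p q : ℕ} (A : Matrix (Fin p) (Fin q) ℝ) :
    {t : ℝ | ∃ (a : Fin p → ℝ) (b : Fin q → ℝ),
      (∀ i, |a i| ≤ 1) ∧ (∀ j, |b j| ≤ 1) ∧ t = ∑ i, ∑ j, A i j * (a i * b j)}.Nonempty :=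
  ⟨_, 0, 0, by simp, by simp, rfl⟩

theorem scalarMax_bddAbove {p q : ℕ} (A : Matrix (Fin p) (Fin q) ℝ) :
    BddAbove {t : ℝ | ∃ (a : Fin p → ℝ) (b : Fin q → ℝ),
      (∀ i, |a i| ≤ 1) ∧ (∀ j, |b j| ≤ 1) ∧ t = ∑ i, ∑ j, A i j * (a i * b j)} := by
  refine ⟨∑ i, ∑ j, |A i j|, ?_⟩
  rintro t ⟨a, b, ha, hb, rfl⟩
  refine Finset.sum_le_sum fun i _ => Finset.sum_le_sum fun j _ => ?_
  refine (le_abs_self _).trans ?_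
  rw [abs_mul, abs_mul]
  exact mul_le_of_le_one_right (abs_nonneg _) (mul_le_one₀ (ha i) (abs_nonneg _) (hb j))

theorem bddBelow_grothendieck : BddBelow {K : ℝ | GrothendieckInequality K} := by
  refine ⟨0, fun K hK => ?_⟩
  have h := hK 1 1 (fun _ _ => 1) 1 (fun _ => EuclideanSpace.single 0 1)
    (fun _ => EuclideanSpace.single 0 1) (by simp) (by simp)
  have h0 : 0 ≤ scalarMax (fun _ _ => 1 : Matrix (Fin 1) (Fin 1) ℝ) :=
    le_csSup (scalarMax_bddAbove _) ⟨0, 0, by simp, by simp, by simp⟩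
  simp at h
  by_contra hneg
  push Not at hneg
  nlinarith

theorem uniform_le {k : ℝ} (hk : k ≤ n) : (1 : ℝ) / 2 ^ n ≤ (2 : ℝ) ^ (-k) := by
  rw [one_div, ← Real.rpow_natCast, ← Real.rpow_neg (by norm_num)]
  exact Real.rpow_le_rpow_of_exponent_le (by norm_num) (by linarith)

theorem classicalValues_nonempty (Ext : Extractor n m d) {k : ℝ} (hk : k ≤ n) :
    (classicalValues Ext k).Nonempty :=
  ⟨_, fun _ => 1 / 2 ^ n, 0,
    ⟨fun _ => by positivity, fun _ => uniform_le hk, by simp, by simp, by simp⟩, rfl⟩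

theorem classicalValues_bddAbove (Ext : Extractor n m d) (k : ℝ) :
    BddAbove (classicalValues Ext k) := by
  refine ⟨1 / 2 ^ d * ∑ i, ∑ s, ∑ j, |coeff Ext i s j|, ?_⟩
  rintro t ⟨z, y, h, rfl⟩
  refine mul_le_mul_of_nonneg_left (Finset.sum_le_sum fun i _ => Finset.sum_le_sum fun s _ =>
    Finset.sum_le_sum fun j _ => ?_) (by positivity)
  have hz : z i ≤ 1 := h.z_sum ▸
    Finset.single_le_sum (fun i _ => h.z_nonneg i) (Finset.mem_univ i)
  refine (mul_le_mul_of_nonneg_right (le_abs_self _)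
    (mul_nonneg (h.z_nonneg i) (h.y_nonneg _))).trans ?_
  exact mul_le_of_le_one_right (abs_nonneg _) (mul_le_one₀ hz (h.y_nonneg _) (h.y_le _))

theorem sdpValues_nonempty (Ext : Extractor n m d) {k : ℝ} (hk : k ≤ n) :
    (sdpValues Ext k).Nonempty := by
  let v : Word n m d → ℝ := fun w => w.elim 1 (Sum.elim (fun _ => 1 / 2 ^ n) (fun _ => 0))
  have hv : ∀ w, 0 ≤ v w := by
    rintro (_ | i | sj) <;> simp [v]
  refine ⟨_, Matrix.vecMulVec v v, ⟨?_, ?_, ?_, ?_, ?_, ?_⟩, rfl⟩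
  · simpa using Matrix.posSemidef_vecMulVec_self_star v
  · exact fun w w' => mul_nonneg (hv w) (hv w')
  · simp [Matrix.vecMulVec_apply, v]
  · intro w
    simp [Matrix.vecMulVec_apply, v]
  · intro i w
    have := mul_le_mul_of_nonneg_right (uniform_le hk) (hv w)
    simpa [Matrix.vecMulVec_apply, v] using this
  · intro s j w
    have := hv w
    simpa [Matrix.vecMulVec_apply, v] using this

theorem sdpValues_bddAbove (Ext : Extractor n m d) (k : ℝ) :
    BddAbove (sdpValues Ext k) := by
  refine ⟨1 / 2 ^ d * ∑ i, ∑ s, ∑ j, |coeff Ext i s j|, ?_⟩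
  rintro t ⟨Ω, h, rfl⟩
  refine mul_le_mul_of_nonneg_left (Finset.sum_le_sum fun i _ => Finset.sum_le_sum fun s _ =>
    Finset.sum_le_sum fun j _ => ?_) (by positivity)
  have h1 : Ω (inW i) (testW s j) ≤ Ω emptyW (testW s j) := by
    rw [h.empty_eq_sum (testW s j)]
    exact Finset.single_le_sum (f := fun i => Ω (inW i) (testW s j))
      (fun i _ => h.nonneg _ _) (Finset.mem_univ i)
  have h2 : Ω emptyW (testW s j) = Ω (testW s j) emptyW := by
    simpa using h.posSemidef.isHermitian.apply (testW s j) emptyW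
  have h3 := h.test_le s j emptyW
  rw [h.empty_empty] at h3
  refine (mul_le_mul_of_nonneg_right (le_abs_self _) (h.nonneg _ _)).trans ?_
  exact mul_le_of_le_one_right (abs_nonneg _) (by linarith)

end QProofExtractor

end

/-!
A matrix `Ω` feasible for the relaxation is the Gram matrix of vectors `a i` and `b (s, j)`, with
`‖a i‖ ≤ 2 ^ (-k)` and `‖b (s, j)‖ ≤ 1`, and both bounds compare the bilinear form of
`M i (s, j) = coeff Ext i s j` on these vectors with its values on scalars.

For the first, Cauchy-Schwarz leaves the sum over `(s, j)` of the squared norms of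
`∑ i, M i (s, j) • a i`, which is `∑ i i', ⟪a i', a i⟫ (M Mᵀ) i' i`. For fixed `i` the weights
`⟪a i', a i⟫` form a multiple of a distribution of min-entropy `k`, and the row `M i` is up to a
constant the test `f_s(i) = j`, so that each `i` contributes at most a multiple of the classical
error, and the multiples add up to `1`.

For the second, Grothendieck's inequality reduces to signed scalars `|x i| ≤ 1` and
`|y (s, j)| ≤ 1`. Constants in `y` are invisible to `M`, and `x` is a difference of two nonnegative
vectors which are flat enough to be multiples of distributions of min-entropy `k - 1`.

Grothendieck's constant is an infimum, so it has to be shown that some constant works. Rademacher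
sums embed the vectors into functions on the discrete cube, where they are truncated at height `2`:
the truncated part is a family of scalars, and the rest has small norm since the fourth moments of
Rademacher sums are bounded, whence it is absorbed into the left-hand side.
-/

namespace QProofExtractor

open Matrix

/-! ### Rademacher sums -/

section Rademacher

variable {r : ℕ}

/-- The Rademacher sum `∑ k, ε k * u k` with coefficients `u`, as a function of the signs `ε`. -/
def rademacherSum (u : Fin r → ℝ) (ε : Fin r → ℤˣ) : ℝ := ∑ k, (ε k : ℤ) * u k

theorem rademacherSum_cons (u : Fin (r + 1) → ℝ) (a : ℤˣ) (ε : Fin r → ℤˣ) :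
    rademacherSum u (Fin.cons a ε) = (a : ℤ) * u 0 + rademacherSum (Fin.tail u) ε := by
  simp [rademacherSum, Fin.sum_univ_succ, Fin.tail]

theorem sum_signs_succ {M : Type*} [AddCommMonoid M] (F : (Fin (r + 1) → ℤˣ) → M) :
    ∑ ε, F ε = ∑ ε : Fin r → ℤˣ, (F (Fin.cons 1 ε) + F (Fin.cons (-1) ε)) := by
  rw [← (Fin.consEquiv fun _ => ℤˣ).sum_comp, Fintype.sum_prod_type_right]
  simp [UnitsInt.univ, Fin.consEquiv]

theorem sum_rademacherSum_mul (u v : Fin r → ℝ) :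
    ∑ ε, rademacherSum u ε * rademacherSum v ε = 2 ^ r * ∑ k, u k * v k := by
  induction r with
  | zero => simp [rademacherSum]
  | succ r ih =>
    have average_sign (ε : Fin r → ℤˣ) :
        rademacherSum u (Fin.cons 1 ε) * rademacherSum v (Fin.cons 1 ε)
          + rademacherSum u (Fin.cons (-1) ε) * rademacherSum v (Fin.cons (-1) ε)
        = 2 * (rademacherSum (Fin.tail u) ε * rademacherSum (Fin.tail v) ε)
          + 2 * (u 0 * v 0) := by
      simp only [rademacherSum_cons]
      push_cast
      ring
    simp only [sum_signs_succ, average_sign, Finset.sum_add_distrib, ← Finset.mul_sum, ih]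
    simp [Fin.sum_univ_succ, Fin.tail]
    ring

theorem sum_rademacherSum_pow_four_le (u : Fin r → ℝ) :
    ∑ ε, rademacherSum u ε ^ 4 ≤ 2 ^ r * (3 * (∑ k, u k ^ 2) ^ 2) := by
  induction r with
  | zero => simp [rademacherSum]
  | succ r ih =>
    have average_sign (ε : Fin r → ℤˣ) :
        rademacherSum u (Fin.cons 1 ε) ^ 4 + rademacherSum u (Fin.cons (-1) ε) ^ 4
        = 2 * rademacherSum (Fin.tail u) ε ^ 4
          + 12 * u 0 ^ 2 * (rademacherSum (Fin.tail u) ε * rademacherSum (Fin.tail u) ε)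
          + 2 * u 0 ^ 4 := by
      simp only [rademacherSum_cons]
      push_cast
      ring
    have sum_sq : ∑ k, u k ^ 2 = u 0 ^ 2 + ∑ k, Fin.tail u k ^ 2 := Fin.sum_univ_succ _
    calc ∑ ε, rademacherSum u ε ^ 4
        = 2 * ∑ ε, rademacherSum (Fin.tail u) ε ^ 4
          + 12 * u 0 ^ 2 * (2 ^ r * ∑ k, Fin.tail u k ^ 2) + 2 ^ r * (2 * u 0 ^ 4) := by
          simp only [sum_signs_succ, average_sign, Finset.sum_add_distrib, ← Finset.mul_sum,
            sum_rademacherSum_mul]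
          simp [sq, mul_left_comm]
      _ ≤ 2 * (2 ^ r * (3 * (∑ k, Fin.tail u k ^ 2) ^ 2))
          + 12 * u 0 ^ 2 * (2 ^ r * ∑ k, Fin.tail u k ^ 2) + 2 ^ r * (6 * u 0 ^ 4) := by
          gcongr
          · exact ih _
          · norm_num
      _ = 2 ^ (r + 1) * (3 * (∑ k, u k ^ 2) ^ 2) := by
          rw [sum_sq]
          ring

/-- The Rademacher sums with coefficients `u` as a vector indexed by the discrete cube. The cube
carries the counting measure, so that `u ↦ rademacher u` multiplies norms by `√(2 ^ r)`. -/
def rademacher (u : EuclideanSpace ℝ (Fin r)) : EuclideanSpace ℝ (Fin r → ℤˣ) :=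
  WithLp.toLp 2 (rademacherSum u)

theorem inner_rademacher (u v : EuclideanSpace ℝ (Fin r)) :
    inner ℝ (rademacher u) (rademacher v) = 2 ^ r * inner ℝ u v := by
  simp only [PiLp.inner_apply, rademacher, Real.inner_apply]
  exact sum_rademacherSum_mul _ _

theorem norm_rademacher (u : EuclideanSpace ℝ (Fin r)) : ‖rademacher u‖ = √(2 ^ r) * ‖u‖ := by
  rw [norm_eq_sqrt_real_inner, inner_rademacher, Real.sqrt_mul (by positivity),
    ← norm_eq_sqrt_real_inner]

end Rademacher

/-! ### Truncation -/

section Truncation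

variable {ι : Type*} [Fintype ι] {M : ℝ}

/-- Truncation of a real number to `[-M, M]`. -/
noncomputable def clip (M t : ℝ) : ℝ := max (-M) (min M t)

theorem abs_clip_le (hM : 0 ≤ M) (t : ℝ) : |clip M t| ≤ M :=
  abs_le.2 ⟨le_max_left _ _, max_le (by linarith) (min_le_left _ _)⟩

theorem abs_clip_le_abs (hM : 0 ≤ M) (t : ℝ) : |clip M t| ≤ |t| := by
  refine abs_le.2 ⟨le_max_of_le_right (le_min ?_ (neg_abs_le t)), max_le ?_ ?_⟩
  · linarith [abs_nonneg t]
  · linarith [abs_nonneg t]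
  · exact (min_le_right _ _).trans (le_abs_self t)

theorem abs_sub_clip_le (hM : 0 < M) (t : ℝ) : |t - clip M t| ≤ t ^ 2 / (4 * M) := by
  have tangent (s : ℝ) : s - M ≤ s ^ 2 / (4 * M) := by
    rw [le_div_iff₀ (by positivity)]
    nlinarith [sq_nonneg (s - 2 * M)]
  have nonneg : 0 ≤ t ^ 2 / (4 * M) := by positivity
  have tangent_neg := tangent (-t)
  rw [neg_sq] at tangent_neg
  unfold clip
  rw [abs_le]
  rcases max_cases (-M) (min M t) with h | h <;> rcases min_cases M t with h' | h' <;>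
    constructor <;> linarith [tangent t]

/-- Coordinatewise truncation of a vector to `[-M, M]`. -/
noncomputable def truncate (M : ℝ) (X : EuclideanSpace ℝ ι) : EuclideanSpace ℝ ι :=
  WithLp.toLp 2 fun e => clip M (X e)

theorem norm_truncate_le (hM : 0 ≤ M) (X : EuclideanSpace ℝ ι) : ‖truncate M X‖ ≤ ‖X‖ := by
  rw [← sq_le_sq₀ (norm_nonneg _) (norm_nonneg _)]
  simp only [EuclideanSpace.real_norm_sq_eq]
  exact Finset.sum_le_sum fun e _ => sq_le_sq.2 (abs_clip_le_abs hM _)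

theorem norm_sub_truncate_sq_le (hM : 0 < M) (X : EuclideanSpace ℝ ι) :
    ‖X - truncate M X‖ ^ 2 ≤ (∑ e, X e ^ 4) / (4 * M) ^ 2 := by
  rw [EuclideanSpace.real_norm_sq_eq, Finset.sum_div]
  refine Finset.sum_le_sum fun e _ => ?_
  calc (X e - clip M (X e)) ^ 2 ≤ (X e ^ 2 / (4 * M)) ^ 2 :=
        sq_le_sq.2 ((abs_sub_clip_le hM _).trans (le_abs_self _))
    _ = X e ^ 4 / (4 * M) ^ 2 := by ring

theorem norm_rademacher_sub_truncate_le {r : ℕ} {u : EuclideanSpace ℝ (Fin r)} (hu : ‖u‖ ≤ 1) :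
    ‖rademacher u - truncate 2 (rademacher u)‖ ≤ √(2 ^ r) / 4 := by
  have fourth_moment : ∑ ε, rademacher u ε ^ 4 ≤ 2 ^ r * 3 := by
    refine (sum_rademacherSum_pow_four_le u).trans ?_
    rw [← EuclideanSpace.real_norm_sq_eq, ← pow_mul]
    gcongr
    exact mul_le_of_le_one_right (by norm_num) (pow_le_one₀ (norm_nonneg _) hu)
  rw [← sq_le_sq₀ (norm_nonneg _) (by positivity)]
  calc ‖rademacher u - truncate 2 (rademacher u)‖ ^ 2
      ≤ 2 ^ r * 3 / (4 * 2) ^ 2 := by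
        refine (norm_sub_truncate_sq_le two_pos _).trans ?_
        gcongr
    _ ≤ (√(2 ^ r) / 4) ^ 2 := by
        rw [div_pow, Real.sq_sqrt (by positivity)]
        linarith [show (0 : ℝ) ≤ 2 ^ r by positivity]

end Truncation

/-! ### Grothendieck's inequality -/

section Grothendieck

variable {α β : Type*} [Fintype α] [Fintype β] {A : Matrix α β ℝ} {B C : ℝ}
  {E F : Type*} [NormedAddCommGroup E] [InnerProductSpace ℝ E]
  [NormedAddCommGroup F] [InnerProductSpace ℝ F]

/-- `C` bounds the bilinear form of `A` on families of vectors in the unit ball of `E`. The two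
sides of Grothendieck's inequality are the cases of `E = ℝ` and of `E` a Euclidean space. -/
def VectorBound (E : Type*) [NormedAddCommGroup E] [InnerProductSpace ℝ E] (A : Matrix α β ℝ)
    (C : ℝ) : Prop :=
  ∀ (x : α → E) (y : β → E), (∀ i, ‖x i‖ ≤ 1) → (∀ j, ‖y j‖ ≤ 1) →
    ∑ i, ∑ j, A i j * inner ℝ (x i) (y j) ≤ C

theorem sum_mul_inner_real (a : α → ℝ) (b : β → ℝ) :
    ∑ i, ∑ j, A i j * inner ℝ (a i) (b j) = a ⬝ᵥ A *ᵥ b := by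
  simp only [dotProduct, mulVec, Finset.mul_sum, Real.inner_apply]
  exact Finset.sum_congr rfl fun i _ => Finset.sum_congr rfl fun j _ => mul_left_comm _ _ _

theorem vectorBound_sum_abs : VectorBound E A (∑ i, ∑ j, |A i j|) := by
  intro x y hx hy
  refine Finset.sum_le_sum fun i _ => Finset.sum_le_sum fun j _ => (le_abs_self _).trans ?_
  rw [abs_mul]
  exact mul_le_of_le_one_right (abs_nonneg _)
    ((abs_real_inner_le_norm _ _).trans (mul_le_one₀ (hx i) (norm_nonneg _) (hy j)))

namespace VectorBound

theorem nonneg (h : VectorBound E A C) : 0 ≤ C := by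
  simpa using h 0 0 (by simp) (by simp)

theorem of_linearIsometry (h : VectorBound F A C) (L : E →ₗᵢ[ℝ] F) : VectorBound E A C := by
  intro x y hx hy
  simpa using h (L ∘ x) (L ∘ y) (by simpa using hx) (by simpa using hy)

theorem of_forall_euclideanSpace_fin [FiniteDimensional ℝ E]
    (h : ∀ r, VectorBound (EuclideanSpace ℝ (Fin r)) A C) : VectorBound E A C :=
  (h _).of_linearIsometry (stdOrthonormalBasis ℝ E).repr.toLinearIsometry

theorem submatrix (h : VectorBound E A C) {α' β' : Type*} [Fintype α'] [Fintype β']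
    (e : α' ≃ α) (f : β' ≃ β) : VectorBound E (A.submatrix e f) C := by
  intro x y hx hy
  have := h (x ∘ e.symm) (y ∘ f.symm) (fun _ => hx _) (fun _ => hy _)
  simpa [← e.sum_comp, ← f.sum_comp] using this

theorem sum_le_mul (h : VectorBound E A C) {x : α → E} {y : β → E} {R S : ℝ} (hR : 0 < R)
    (hS : 0 < S) (hx : ∀ i, ‖x i‖ ≤ R) (hy : ∀ j, ‖y j‖ ≤ S) :
    ∑ i, ∑ j, A i j * inner ℝ (x i) (y j) ≤ R * S * C := by
  have norm_inv_smul_le {T : ℝ} (hT : 0 < T) {u : E} (hu : ‖u‖ ≤ T) : ‖T⁻¹ • u‖ ≤ 1 := by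
    rwa [norm_smul, norm_inv, Real.norm_of_nonneg hT.le, inv_mul_le_one₀ hT]
  have scaled := h (fun i => R⁻¹ • x i) (fun j => S⁻¹ • y j)
    (fun i => norm_inv_smul_le hR (hx i)) (fun j => norm_inv_smul_le hS (hy j))
  calc ∑ i, ∑ j, A i j * inner ℝ (x i) (y j)
      = R * S * ∑ i, ∑ j, A i j * inner ℝ (R⁻¹ • x i) (S⁻¹ • y j) := by
        simp only [real_inner_smul_left, real_inner_smul_right, Finset.mul_sum]
        refine Finset.sum_congr rfl fun i _ => Finset.sum_congr rfl fun j _ => ?_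
        field_simp
    _ ≤ R * S * C := by gcongr

theorem sum_le_of_abs_apply_le (h : VectorBound ℝ A B) {ι : Type*} [Fintype ι]
    {x : α → EuclideanSpace ℝ ι} {y : β → EuclideanSpace ℝ ι} {R : ℝ} (hR : 0 < R)
    (hx : ∀ i e, |x i e| ≤ R) (hy : ∀ j e, |y j e| ≤ R) :
    ∑ i, ∑ j, A i j * inner ℝ (x i) (y j) ≤ Fintype.card ι * (R ^ 2 * B) := by
  calc ∑ i, ∑ j, A i j * inner ℝ (x i) (y j)
      = ∑ e, ∑ i, ∑ j, A i j * inner ℝ (x i e) (y j e) := by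
        simp only [PiLp.inner_apply, Finset.mul_sum]
        rw [Finset.sum_comm (s := (Finset.univ : Finset ι))]
        exact Finset.sum_congr rfl fun i _ => Finset.sum_comm
    _ ≤ ∑ _e : ι, R * R * B :=
        Finset.sum_le_sum fun e _ => h.sum_le_mul hR hR (hx · e) (hy · e)
    _ = Fintype.card ι * (R ^ 2 * B) := by simp [sq]

theorem euclideanSpace_four_mul_add_half {r : ℕ} (hB : VectorBound ℝ A B)
    (hC : VectorBound (EuclideanSpace ℝ (Fin r → ℤˣ)) A C) :
    VectorBound (EuclideanSpace ℝ (Fin r)) A (4 * B + C / 2) := by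
  intro x y hx hy
  set X := fun i => rademacher (x i)
  set Y := fun j => rademacher (y j)
  have sqrt_pos : 0 < √((2 : ℝ) ^ r) := by positivity
  have norm_le {u : EuclideanSpace ℝ (Fin r)} (hu : ‖u‖ ≤ 1) : ‖rademacher u‖ ≤ √(2 ^ r) := by
    rw [norm_rademacher]
    exact mul_le_of_le_one_right sqrt_pos.le hu
  have norm_truncate_rademacher_le {u : EuclideanSpace ℝ (Fin r)} (hu : ‖u‖ ≤ 1) :
      ‖truncate 2 (rademacher u)‖ ≤ √(2 ^ r) := (norm_truncate_le zero_le_two _).trans (norm_le hu)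
  have truncated : ∑ i, ∑ j, A i j * inner ℝ (truncate 2 (X i)) (truncate 2 (Y j))
      ≤ 2 ^ r * (4 * B) := by
    refine (hB.sum_le_of_abs_apply_le two_pos (fun _ _ => abs_clip_le zero_le_two _)
      (fun _ _ => abs_clip_le zero_le_two _)).trans_eq ?_
    norm_num
  have remainder_left := hC.sum_le_mul (x := fun i => X i - truncate 2 (X i))
    (y := fun j => truncate 2 (Y j)) (by positivity) sqrt_pos
    (fun i => norm_rademacher_sub_truncate_le (hx i)) (fun j => norm_truncate_rademacher_le (hy j))
  have remainder_right := hC.sum_le_mul (x := X)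
    (y := fun j => Y j - truncate 2 (Y j)) sqrt_pos (by positivity)
    (fun i => norm_le (hx i)) (fun j => norm_rademacher_sub_truncate_le (hy j))
  refine le_of_mul_le_mul_left ?_ (show (0 : ℝ) < 2 ^ r by positivity)
  calc 2 ^ r * ∑ i, ∑ j, A i j * inner ℝ (x i) (y j)
      = ∑ i, ∑ j, A i j * inner ℝ (truncate 2 (X i)) (truncate 2 (Y j))
        + ∑ i, ∑ j, A i j * inner ℝ (X i - truncate 2 (X i)) (truncate 2 (Y j))
        + ∑ i, ∑ j, A i j * inner ℝ (X i) (Y j - truncate 2 (Y j)) := by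
        simp only [Finset.mul_sum, mul_left_comm _ (A _ _), ← inner_rademacher,
          ← Finset.sum_add_distrib, ← mul_add, inner_sub_left, inner_sub_right]
        refine Finset.sum_congr rfl fun i _ => Finset.sum_congr rfl fun j _ => ?_
        ring
    _ ≤ 2 ^ r * (4 * B) + √(2 ^ r) / 4 * √(2 ^ r) * C + √(2 ^ r) * (√(2 ^ r) / 4) * C := by
        gcongr
    _ = 2 ^ r * (4 * B + C / 2) := by
        linear_combination C / 2 * Real.mul_self_sqrt (show (0 : ℝ) ≤ 2 ^ r by positivity)

theorem euclideanSpace_eight_mul (hB : VectorBound ℝ A B) (r : ℕ) :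
    VectorBound (EuclideanSpace ℝ (Fin r)) A (8 * B) := by
  set bounds := {C : ℝ | ∀ r, VectorBound (EuclideanSpace ℝ (Fin r)) A C}
  have nonempty : bounds.Nonempty := ⟨_, fun _ => vectorBound_sum_abs⟩
  have bddBelow : BddBelow bounds := ⟨0, fun C hC => (hC 0).nonneg⟩
  have attained : sInf bounds ∈ bounds := fun r x y hx hy =>
    le_csInf nonempty fun C hC => hC r x y hx hy
  have improved : sInf bounds ≤ 4 * B + sInf bounds / 2 :=
    csInf_le bddBelow fun _ =>
      hB.euclideanSpace_four_mul_add_half (of_forall_euclideanSpace_fin attained)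
  exact fun x y hx hy => (attained r x y hx hy).trans (by linarith)

end VectorBound

theorem vectorBound_scalarMax {p q : ℕ} (A : Matrix (Fin p) (Fin q) ℝ) :
    VectorBound ℝ A (scalarMax A) := fun a b ha hb =>
  le_csSup (scalarMax_bddAbove A) ⟨a, b, ha, hb, by simp only [Real.inner_apply]⟩

theorem VectorBound.scalarMax_le {p q : ℕ} {A : Matrix (Fin p) (Fin q) ℝ}
    (h : VectorBound ℝ A B) : scalarMax A ≤ B := by
  refine csSup_le (scalarMax_nonempty A) ?_
  rintro t ⟨a, b, ha, hb, rfl⟩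
  simpa only [Real.inner_apply] using h a b ha hb

theorem grothendieckInequality_eight : GrothendieckInequality 8 :=
  fun _ _ A r => (vectorBound_scalarMax A).euclideanSpace_eight_mul r

theorem grothendieckInequality_grothendieckConstant :
    GrothendieckInequality grothendieckConstant := by
  intro p q A r x y hx hy
  rcases (vectorBound_scalarMax A).nonneg.eq_or_lt with scalarMax_eq | scalarMax_pos
  · simpa [← scalarMax_eq] using grothendieckInequality_eight p q A r x y hx hy
  · rw [← div_le_iff₀ scalarMax_pos]
    refine le_csInf ⟨8, grothendieckInequality_eight⟩ fun K hK => ?_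
    rw [div_le_iff₀ scalarMax_pos]
    exact hK p q A r x y hx hy

theorem GrothendieckInequality.nonneg {K : ℝ} (h : GrothendieckInequality K) : 0 ≤ K := by
  have one_le : 1 ≤ K * scalarMax (1 : Matrix (Fin 1) (Fin 1) ℝ) := by
    simpa using h 1 1 1 1 (fun _ => EuclideanSpace.single 0 1) (fun _ => EuclideanSpace.single 0 1)
      (by simp) (by simp)
  exact (pos_of_mul_pos_left (one_pos.trans_le one_le) (vectorBound_scalarMax _).nonneg).le

theorem grothendieckConstant_nonneg : 0 ≤ grothendieckConstant :=
  grothendieckInequality_grothendieckConstant.nonneg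

theorem VectorBound.grothendieckConstant_mul [FiniteDimensional ℝ E] (hB : VectorBound ℝ A B) :
    VectorBound E A (grothendieckConstant * B) := by
  set A' := A.submatrix (Fintype.equivFin α).symm (Fintype.equivFin β).symm
  have reindexed (r : ℕ) : VectorBound (EuclideanSpace ℝ (Fin r)) A' (grothendieckConstant * B) :=
    fun x y hx hy => (grothendieckInequality_grothendieckConstant _ _ A' r x y hx hy).trans <|
      mul_le_mul_of_nonneg_left (hB.submatrix _ _).scalarMax_le grothendieckConstant_nonneg
  have := (VectorBound.of_forall_euclideanSpace_fin (E := E) reindexed).submatrix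
    (Fintype.equivFin α) (Fintype.equivFin β)
  simpa [A'] using this

end Grothendieck

/-! ### Flat vectors -/

section Flat

variable {ι τ : Type*} [Fintype ι] [Fintype τ] {c c' : ℝ} {z : ι → ℝ}

/-- A nonnegative vector `z` is `c`-flat if no entry exceeds the share `c` of the total. Thus the
`2 ^ (-k)`-flat vectors are the nonnegative multiples of distributions of min-entropy at least `k`,
including the zero vector. -/
def IsFlat (c : ℝ) (z : ι → ℝ) : Prop := ∀ i, 0 ≤ z i ∧ z i ≤ c * ∑ i', z i'

namespace IsFlat

theorem sum_nonneg (hz : IsFlat c z) : 0 ≤ ∑ i, z i := Finset.sum_nonneg fun i _ => (hz i).1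

theorem mono (hz : IsFlat c z) (hc : c ≤ c') : IsFlat c' z := fun i =>
  ⟨(hz i).1, (hz i).2.trans (mul_le_mul_of_nonneg_right hc hz.sum_nonneg)⟩

theorem smul (hz : IsFlat c z) {r : ℝ} (hr : 0 ≤ r) : IsFlat c (r • z) := by
  intro i
  simp only [Pi.smul_apply, smul_eq_mul, ← Finset.mul_sum]
  exact ⟨mul_nonneg hr (hz i).1, by linarith [mul_le_mul_of_nonneg_left (hz i).2 hr]⟩

end IsFlat

theorem isFlat_of_le_two_mul_sum [Nonempty ι] {b : ℝ} (hz : ∀ i, 0 ≤ z i) (hb : ∀ i, z i ≤ b)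
    (hsum : Fintype.card ι * b ≤ 2 * ∑ i, z i) : IsFlat (2 / Fintype.card ι) z := fun i => by
  refine ⟨hz i, (hb i).trans ?_⟩
  rwa [div_mul_eq_mul_div, le_div_iff₀' (Nat.cast_pos.2 Fintype.card_pos)]

theorem exists_isFlat_sub_isFlat [Nonempty ι] {a : ι → ℝ} (ha : ∀ i, |a i| ≤ 1)
    (hsum : 0 ≤ ∑ i, a i) :
    ∃ u w : ι → ℝ, IsFlat (2 / Fintype.card ι) u ∧ IsFlat (2 / Fintype.card ι) w ∧ a = u - w ∧
      ∑ i, u i + ∑ i, w i ≤ 2 * Fintype.card ι := by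
  set N : ℝ := (Fintype.card ι : ℝ) with hN
  have N_pos : 0 < N := Nat.cast_pos.2 Fintype.card_pos
  have one_add_nonneg (i : ι) : 0 ≤ 1 + a i := by linarith [(abs_le.1 (ha i)).1]
  have one_add_le (i : ι) : 1 + a i ≤ 2 := by linarith [(abs_le.1 (ha i)).2]
  have sum_one_add : ∑ i, (1 + a i) = N + ∑ i, a i := by simp [Finset.sum_add_distrib, N]
  -- Moving the share `p` of `1 + a` to the other side makes `w` as small as its flatness allows.
  set p : ℝ := N / (2 * (N + ∑ i, a i))
  have p_nonneg : 0 ≤ p := by positivity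
  have p_le : p ≤ 1 / 2 := by
    rw [div_le_div_iff₀ (by positivity) two_pos]
    linarith
  have p_mul_sum : p * (N + ∑ i, a i) = N / 2 := by
    have : N + ∑ i, a i ≠ 0 := by positivity
    simp only [p]
    field_simp
  have sum_w : ∑ i, (1 - p * (1 + a i)) = N / 2 := by
    rw [Finset.sum_sub_distrib, ← Finset.mul_sum, sum_one_add, p_mul_sum]
    simp only [Finset.sum_const, Finset.card_univ, nsmul_eq_mul, ← hN]
    ring
  refine ⟨(1 - p) • (1 + a), fun i => 1 - p * (1 + a i), IsFlat.smul ?_ (by linarith), ?_, ?_, ?_⟩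
  · refine isFlat_of_le_two_mul_sum one_add_nonneg one_add_le ?_
    simp only [Pi.add_apply, Pi.one_apply, sum_one_add]
    linarith
  · refine isFlat_of_le_two_mul_sum (b := 1) (fun i => ?_) (fun i => ?_) ?_
    · nlinarith [one_add_nonneg i, one_add_le i]
    · linarith [mul_nonneg p_nonneg (one_add_nonneg i)]
    · rw [sum_w]
      linarith
  · ext i
    simp
    ring
  · have sum_le : ∑ i, (1 + a i) ≤ 2 * N :=
      (Finset.sum_le_sum fun i _ => one_add_le i).trans_eq (by simp [N, mul_comm])
    simp only [Pi.smul_apply, Pi.add_apply, Pi.one_apply, smul_eq_mul, ← Finset.mul_sum,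
      sum_one_add, sum_w] at sum_le ⊢
    linarith

theorem vectorBound_real_of_forall_isFlat [Nonempty ι] {A : Matrix ι τ ℝ} {C : ℝ}
    (h : ∀ (z : ι → ℝ) (y : τ → ℝ), IsFlat (2 / Fintype.card ι) z → (∀ t, |y t| ≤ 1) →
      z ⬝ᵥ A *ᵥ y ≤ (∑ i, z i) * C) :
    VectorBound ℝ A (2 * Fintype.card ι * C) := by
  intro a b ha hb
  rw [sum_mul_inner_real]
  wlog sum_nonneg : 0 ≤ ∑ i, a i generalizing a b
  · simpa [mulVec_neg] using this (-a) (-b) (by simpa using ha) (by simpa using hb)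
      (by simpa using (not_le.1 sum_nonneg).le)
  have isFlat_one : IsFlat (2 / Fintype.card ι) (1 : ι → ℝ) :=
    isFlat_of_le_two_mul_sum (b := 1) (by simp) (by simp) (by simp [two_mul])
  have C_nonneg : 0 ≤ C := by
    simpa [mul_nonneg_iff_of_pos_left, Fintype.card_pos] using h 1 0 isFlat_one (by simp)
  obtain ⟨u, w, hu, hw, rfl, sum_le⟩ := exists_isFlat_sub_isFlat ha sum_nonneg
  calc (u - w) ⬝ᵥ A *ᵥ b = u ⬝ᵥ A *ᵥ b + w ⬝ᵥ A *ᵥ (-b) := by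
        rw [sub_dotProduct, mulVec_neg, dotProduct_neg, sub_eq_add_neg]
    _ ≤ (∑ i, u i) * C + (∑ i, w i) * C :=
        add_le_add (h u b hu hb) (h w (-b) hw (by simpa using hb))
    _ ≤ 2 * Fintype.card ι * C := by
        rw [← add_mul]
        exact mul_le_mul_of_nonneg_right sum_le C_nonneg

end Flat

/-! ### Bilinear forms on vectors -/

section BilinearForms

variable {ι τ : Type*} [Fintype ι] [Fintype τ]
  {E : Type*} [NormedAddCommGroup E] [InnerProductSpace ℝ E]

theorem sum_norm_sq_sum_smul (A : Matrix ι τ ℝ) (x : ι → E) :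
    ∑ t, ‖∑ i, A i t • x i‖ ^ 2 = ∑ i, (fun i' => inner ℝ (x i') (x i)) ⬝ᵥ A *ᵥ A i := by
  simp only [← real_inner_self_eq_norm_sq, sum_inner, inner_sum, real_inner_smul_left,
    real_inner_smul_right, dotProduct, mulVec, Finset.mul_sum]
  rw [Finset.sum_comm]
  refine Finset.sum_congr rfl fun i _ => ?_
  rw [Finset.sum_comm]
  refine Finset.sum_congr rfl fun i' _ => Finset.sum_congr rfl fun t _ => ?_
  ring

theorem sum_mul_inner_le_sqrt (A : Matrix ι τ ℝ) (x : ι → E) {y : τ → E} (hy : ∀ t, ‖y t‖ ≤ 1) :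
    ∑ i, ∑ t, A i t * inner ℝ (x i) (y t)
      ≤ √(Fintype.card τ * ∑ t, ‖∑ i, A i t • x i‖ ^ 2) := by
  calc ∑ i, ∑ t, A i t * inner ℝ (x i) (y t)
      = ∑ t, inner ℝ (∑ i, A i t • x i) (y t) := by
        rw [Finset.sum_comm]
        simp only [sum_inner, real_inner_smul_left]
    _ ≤ ∑ t, ‖∑ i, A i t • x i‖ := Finset.sum_le_sum fun t _ =>
        (real_inner_le_norm _ _).trans (mul_le_of_le_one_right (norm_nonneg _) (hy t))
    _ ≤ √(Fintype.card τ * ∑ t, ‖∑ i, A i t • x i‖ ^ 2) :=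
        Real.le_sqrt_of_sq_le sq_sum_le_card_mul_sum_sq

open scoped ComplexOrder in
theorem exists_eq_gram_of_posSemidef {𝕜 : Type*} [RCLike 𝕜] {κ : Type*} [Finite κ]
    {M : Matrix κ κ 𝕜} (hM : M.PosSemidef) :
    ∃ (r : ℕ) (v : κ → EuclideanSpace 𝕜 (Fin r)), M = gram 𝕜 v := by
  obtain ⟨r, u, rfl⟩ := posSemidef_iff_eq_sum_vecMulVec.1 hM
  refine ⟨r, fun w => WithLp.toLp 2 fun e => star (u e w), ?_⟩
  ext w w'
  simp [gram_apply, PiLp.inner_apply, Matrix.sum_apply, vecMulVec_apply, mul_comm]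

end BilinearForms

/-! ### The classical error -/

section Extractor

variable {n m d : ℕ} {Ext : Extractor n m d} {k : ℝ}

/-- The coefficients of both programs as a matrix with rows `i` and columns `(s, j)`, so that the
programs become bilinear forms. The factor `1 / 2 ^ d` of the objectives is not included. -/
noncomputable def coeffMatrix (Ext : Extractor n m d) :
    Matrix (Fin (2 ^ n)) (Fin (2 ^ d) × Fin (2 ^ m)) ℝ := of fun i sj => coeff Ext i sj.1 sj.2

theorem coeffMatrix_row_eq (Ext : Extractor n m d) (i : Fin (2 ^ n)) :
    coeffMatrix Ext i = (fun sj => if Ext sj.1 i = sj.2 then 1 else 0) - (1 / 2 ^ m : ℝ) • 1 := by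
  ext sj
  simp [coeffMatrix, coeff]

theorem coeffMatrix_mulVec_one (Ext : Extractor n m d) : coeffMatrix Ext *ᵥ 1 = 0 := by
  ext i
  simp only [mulVec, dotProduct, coeffMatrix, coeff, of_apply, Pi.one_apply, mul_one,
    Fintype.sum_prod_type]
  simp

theorem classicalObjective_eq (Ext : Extractor n m d) (z : Fin (2 ^ n) → ℝ)
    (y : Fin (2 ^ d) × Fin (2 ^ m) → ℝ) :
    classicalObjective Ext z y = 1 / 2 ^ d * (z ⬝ᵥ coeffMatrix Ext *ᵥ y) := by
  simp only [classicalObjective, coeffMatrix, dotProduct, mulVec, of_apply, Finset.mul_sum,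
    Fintype.sum_prod_type, mul_left_comm]

theorem err_nonneg (Ext : Extractor n m d) (hk : k ≤ n) : 0 ≤ Err Ext k := by
  have uniform : ClassicalFeasible k (fun _ : Fin (2 ^ n) => 1 / 2 ^ n)
      (0 : Fin (2 ^ d) × Fin (2 ^ m) → ℝ) :=
    ⟨fun _ => by positivity, fun _ => uniform_le hk, by simp, by simp, by simp⟩
  exact le_csSup (classicalValues_bddAbove Ext k) ⟨_, _, uniform, by simp [classicalObjective]⟩

theorem ClassicalFeasible.dotProduct_coeffMatrix_mulVec_le {z : Fin (2 ^ n) → ℝ}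
    {y : Fin (2 ^ d) × Fin (2 ^ m) → ℝ} (h : ClassicalFeasible k z y) :
    z ⬝ᵥ coeffMatrix Ext *ᵥ y ≤ 2 ^ d * Err Ext k := by
  have objective_le : classicalObjective Ext z y ≤ Err Ext k :=
    le_csSup (classicalValues_bddAbove Ext k) ⟨z, y, h, rfl⟩
  rwa [classicalObjective_eq, one_div, inv_mul_le_iff₀ (by positivity)] at objective_le

namespace IsFlat

variable {z : Fin (2 ^ n) → ℝ} {y : Fin (2 ^ d) × Fin (2 ^ m) → ℝ}

theorem dotProduct_coeffMatrix_mulVec_le (hz : IsFlat (2 ^ (-k)) z) (hy₀ : ∀ sj, 0 ≤ y sj)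
    (hy₁ : ∀ sj, y sj ≤ 1) :
    z ⬝ᵥ coeffMatrix Ext *ᵥ y ≤ (∑ i, z i) * (2 ^ d * Err Ext k) := by
  rcases hz.sum_nonneg.eq_or_lt with sum_eq | sum_pos
  · have z_eq : z = 0 := by
      ext i
      simpa using (Finset.sum_eq_zero_iff_of_nonneg fun i _ => (hz i).1).1 sum_eq.symm i
    simp [z_eq]
  · have feasible : ClassicalFeasible k ((∑ i, z i)⁻¹ • z) y :=
      ⟨fun i => mul_nonneg (inv_nonneg.2 sum_pos.le) (hz i).1,
        fun i => (inv_mul_le_iff₀ sum_pos).2 (by linarith [(hz i).2]),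
        by simp [← Finset.mul_sum, sum_pos.ne'], hy₀, hy₁⟩
    have := feasible.dotProduct_coeffMatrix_mulVec_le (Ext := Ext)
    rwa [smul_dotProduct, smul_eq_mul, inv_mul_le_iff₀ sum_pos] at this

theorem dotProduct_coeffMatrix_mulVec_le_of_abs_le (hz : IsFlat (2 ^ (-k)) z)
    (hy : ∀ sj, |y sj| ≤ 1) :
    z ⬝ᵥ coeffMatrix Ext *ᵥ y ≤ (∑ i, z i) * (2 * (2 ^ d * Err Ext k)) := by
  have test_le : z ⬝ᵥ coeffMatrix Ext *ᵥ ((1 / 2 : ℝ) • (1 + y))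
      ≤ (∑ i, z i) * (2 ^ d * Err Ext k) := by
    refine hz.dotProduct_coeffMatrix_mulVec_le (fun sj => ?_) (fun sj => ?_)
    · simpa using by linarith [(abs_le.1 (hy sj)).1]
    · simp only [Pi.smul_apply, Pi.add_apply, Pi.one_apply, smul_eq_mul]
      linarith [(abs_le.1 (hy sj)).2]
  rw [mulVec_smul, mulVec_add, coeffMatrix_mulVec_one, zero_add, dotProduct_smul,
    smul_eq_mul] at test_le
  linarith

theorem dotProduct_coeffMatrix_mulVec_row_le (hz : IsFlat (2 ^ (-k)) z) (i : Fin (2 ^ n)) :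
    z ⬝ᵥ coeffMatrix Ext *ᵥ coeffMatrix Ext i ≤ (∑ i', z i') * (2 ^ d * Err Ext k) := by
  rw [coeffMatrix_row_eq, mulVec_sub, mulVec_smul, coeffMatrix_mulVec_one, smul_zero, sub_zero]
  refine hz.dotProduct_coeffMatrix_mulVec_le (fun sj => ?_) (fun sj => ?_) <;>
    split_ifs <;> norm_num

end IsFlat

theorem vectorBound_coeffMatrix (hk : k ≤ n) :
    VectorBound ℝ (coeffMatrix Ext) (2 * 2 ^ n * (2 * (2 ^ d * Err Ext (k - 1)))) := by
  have share_le : (2 : ℝ) / 2 ^ n ≤ 2 ^ (-(k - 1)) := by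
    rw [neg_sub, sub_eq_add_neg, Real.rpow_add two_pos, Real.rpow_one]
    linarith [uniform_le hk, show (2 : ℝ) / 2 ^ n = 2 * (1 / 2 ^ n) by ring]
  simpa using vectorBound_real_of_forall_isFlat (A := coeffMatrix Ext) fun z y hz hy =>
    (hz.mono (by simpa using share_le)).dotProduct_coeffMatrix_mulVec_le_of_abs_le hy

/-! ### The relaxation -/

namespace SdpFeasible

variable {Ω : Matrix (Word n m d) (Word n m d) ℝ} (h : SdpFeasible k Ω)

include h

theorem apply_comm (w w' : Word n m d) : Ω w w' = Ω w' w := by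
  simpa using h.posSemidef.isHermitian.apply w' w

theorem isFlat_col (w : Word n m d) : IsFlat (2 ^ (-k)) fun i => Ω (inW i) w := fun i =>
  ⟨h.nonneg _ _, by simpa only [← h.empty_eq_sum] using h.in_le i w⟩

theorem in_in_le (i : Fin (2 ^ n)) : Ω (inW i) (inW i) ≤ (2 ^ (-k)) ^ 2 :=
  calc Ω (inW i) (inW i) ≤ 2 ^ (-k) * Ω emptyW (inW i) := h.in_le i _
    _ = 2 ^ (-k) * Ω (inW i) emptyW := by rw [h.apply_comm]
    _ ≤ 2 ^ (-k) * (2 ^ (-k) * Ω emptyW emptyW) := by gcongr; exact h.in_le i _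
    _ = (2 ^ (-k)) ^ 2 := by rw [h.empty_empty, mul_one, sq]

theorem test_test_le (s : Fin (2 ^ d)) (j : Fin (2 ^ m)) : Ω (testW s j) (testW s j) ≤ 1 :=
  calc Ω (testW s j) (testW s j) ≤ Ω emptyW (testW s j) := h.test_le s j _
    _ = Ω (testW s j) emptyW := h.apply_comm _ _
    _ ≤ 1 := (h.test_le s j _).trans_eq h.empty_empty

theorem exists_gram : ∃ (r : ℕ) (v : Word n m d → EuclideanSpace ℝ (Fin r)), Ω = gram ℝ v ∧
    (∀ i, ‖v (inW i)‖ ≤ 2 ^ (-k)) ∧ ∀ s j, ‖v (testW s j)‖ ≤ 1 := by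
  obtain ⟨r, v, rfl⟩ := exists_eq_gram_of_posSemidef h.posSemidef
  have norm_sq (w : Word n m d) : ‖v w‖ ^ 2 = gram ℝ v w w := by
    rw [gram_apply, real_inner_self_eq_norm_sq]
  refine ⟨r, v, rfl, fun i => ?_, fun s j => ?_⟩
  · rw [← sq_le_sq₀ (norm_nonneg _) (by positivity), norm_sq]
    exact h.in_in_le i
  · rw [← sq_le_one_iff₀ (norm_nonneg _), norm_sq]
    exact h.test_test_le s j

theorem sum_collision_le :
    ∑ i, (fun i' => Ω (inW i') (inW i)) ⬝ᵥ coeffMatrix Ext *ᵥ coeffMatrix Ext i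
      ≤ 2 ^ d * Err Ext k := by
  have total : ∑ i, Ω emptyW (inW i) = 1 := by
    rw [← h.empty_empty, h.empty_eq_sum]
    exact Finset.sum_congr rfl fun i _ => h.apply_comm _ _
  calc ∑ i, (fun i' => Ω (inW i') (inW i)) ⬝ᵥ coeffMatrix Ext *ᵥ coeffMatrix Ext i
      ≤ ∑ i, Ω emptyW (inW i) * (2 ^ d * Err Ext k) := Finset.sum_le_sum fun i _ => by
        rw [h.empty_eq_sum]
        exact (h.isFlat_col (inW i)).dotProduct_coeffMatrix_mulVec_row_le i
    _ = 2 ^ d * Err Ext k := by rw [← Finset.sum_mul, total, one_mul]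

end SdpFeasible

theorem sdpObjective_gram (Ext : Extractor n m d) {E : Type*} [NormedAddCommGroup E]
    [InnerProductSpace ℝ E] (v : Word n m d → E) :
    sdpObjective Ext (gram ℝ v) = 1 / 2 ^ d * ∑ i, ∑ sj : Fin (2 ^ d) × Fin (2 ^ m),
      coeffMatrix Ext i sj * inner ℝ (v (inW i)) (v (testW sj.1 sj.2)) := by
  simp only [sdpObjective, gram_apply, coeffMatrix, of_apply, Fintype.sum_prod_type]

namespace SdpFeasible

variable {Ω : Matrix (Word n m d) (Word n m d) ℝ}

theorem sdpObjective_le_sqrt (h : SdpFeasible k Ω) :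
    sdpObjective Ext Ω ≤ √(2 ^ m) * √(Err Ext k) := by
  obtain ⟨r, v, rfl, -, norm_test_le⟩ := h.exists_gram
  have collision_le := h.sum_collision_le (Ext := Ext)
  simp only [gram_apply, ← sum_norm_sq_sum_smul] at collision_le
  have cauchy_schwarz := sum_mul_inner_le_sqrt (coeffMatrix Ext) (fun i => v (inW i))
    fun sj => norm_test_le sj.1 sj.2
  simp only [Fintype.card_prod, Fintype.card_fin, Nat.cast_mul, Nat.cast_pow,
    Nat.cast_ofNat] at cauchy_schwarz
  rw [sdpObjective_gram, one_div, inv_mul_le_iff₀ (by positivity)]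
  refine cauchy_schwarz.trans ?_
  calc √(2 ^ d * 2 ^ m * ∑ sj, ‖∑ i, coeffMatrix Ext i sj • v (inW i)‖ ^ 2)
      ≤ √(2 ^ d * 2 ^ m * (2 ^ d * Err Ext k)) := by gcongr
    _ = √((2 ^ d) ^ 2 * (2 ^ m * Err Ext k)) := by ring_nf
    _ = 2 ^ d * (√(2 ^ m) * √(Err Ext k)) := by
        rw [Real.sqrt_mul (by positivity), Real.sqrt_sq (by positivity),
          Real.sqrt_mul (by positivity)]

theorem sdpObjective_le_grothendieckConstant_mul (h : SdpFeasible k Ω) (hk : k ≤ n) :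
    sdpObjective Ext Ω ≤ 4 * grothendieckConstant * 2 ^ ((n : ℝ) - k) * Err Ext (k - 1) := by
  obtain ⟨r, v, rfl, norm_in_le, norm_test_le⟩ := h.exists_gram
  have vector_bound := (vectorBound_coeffMatrix (Ext := Ext) hk).grothendieckConstant_mul
    (E := EuclideanSpace ℝ (Fin r))
  rw [sdpObjective_gram, one_div, inv_mul_le_iff₀ (by positivity)]
  refine (vector_bound.sum_le_mul (by positivity) one_pos norm_in_le
    fun sj => norm_test_le sj.1 sj.2).trans_eq ?_
  rw [sub_eq_add_neg (n : ℝ), Real.rpow_add two_pos, Real.rpow_natCast]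
  ring

end SdpFeasible

end Extractor

end QProofExtractor

theorem mainTheorem3_general (n m d : ℕ) (Ext : QProofExtractor.Extractor n m d)
    (k : ℝ) (hk : k ≤ n) :
    QProofExtractor.ErrSdp Ext k ≤ √((2 : ℝ) ^ m) * √(QProofExtractor.Err Ext k) ∧
      QProofExtractor.ErrSdp Ext k
        ≤ 4 * QProofExtractor.grothendieckConstant * (2 : ℝ) ^ ((n : ℝ) - k)
            * QProofExtractor.Err Ext (k - 1) := by
  constructor <;> refine csSup_le (QProofExtractor.sdpValues_nonempty Ext hk) ?_ <;>
    rintro _ ⟨Ω, h, rfl⟩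
  · exact h.sdpObjective_le_sqrt
  · exact h.sdpObjective_le_grothendieckConstant_mul hk

theorem mainTheorem3 (n m d : ℕ) (Ext : QProofExtractor.Extractor n m d)
    (k : ℝ) (hk : k ≤ n) :
    QProofExtractor.ErrSdp Ext k
        ≤ √2 * √((2 : ℝ) ^ m) * √(QProofExtractor.Err Ext k) ∧
      QProofExtractor.ErrSdp Ext k
        ≤ 6 * QProofExtractor.grothendieckConstant * (2 : ℝ) ^ ((n : ℝ) - k)
            * QProofExtractor.Err Ext (k - 1) := by
  obtain ⟨sqrt_bound, grothendieck_bound⟩ := mainTheorem3_general n m d Ext k hk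
  have err_nonneg := QProofExtractor.err_nonneg Ext (k := k - 1) (by linarith)
  have constant_nonneg := QProofExtractor.grothendieckConstant_nonneg
  refine ⟨sqrt_bound.trans ?_, grothendieck_bound.trans ?_⟩
  · rw [mul_assoc]
    exact le_mul_of_one_le_left (by positivity) (Real.one_le_sqrt.2 one_le_two)
  · gcongr
    norm_num
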